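/- **Theorem.** Let $\mu$ be Lebesgue measure, and let $\mathcal M(\mathbb R)$ be the set of functions $\Psi:\mathbb R\to\mathbb R$ that are measurable and essentially bounded on every compact set and for which the closure of the set of discontinuity points of $\Psi$ is $\mu$-null. For $r\ge 1$, $V\subset\mathbb R^r$ and $\Theta\subset\mathbb R$ put $$\mathcal N_r(\Psi,V,\Theta)=\operatorname{span}\{\,x\mapsto\Psi(v^{\mathrm T}x+\theta)\ :\ v\in V,\ \theta\in\Theta\,\},\qquad \Sigma^r(\Psi)=\mathcal N_r(\Psi,\mathbb R^r,\mathbb R).$$ A set $S$ of functions on $\mathbb R^r$ is called *dense in $C(\mathbb R^r)$ for locally uniform convergence* if for every nonempty compact $K\subset\mathbb R^r$, every $g\in C(K)$ and every $\varepsilon>0$ there is $f\in S$ with $|f(x)-g(x)|<\varepsilon$ for almost every $x\in K$ (that is, functions are identified when they agree a.e., and the distance is that of $L^\infty(K)$); it is called *pointwise-uniformly dense* if $f$ can be chosen with $|f(x)-g(x)|<\varepsilon$ for every $x\in K$. Let $\Psi\in\mathcal M(\mathbb R)$. 1. For every $r\ge1$: $\Sigma^r(\Psi)$ is dense in $C(\mathbb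 R^r)$ for locally uniform convergence if and only if there is no polynomial $P$ in one variable with $\Psi=P$ $\mu$-a.e. on $\mathbb R$. 2. Let $W\subset\mathbb R$ have no isolated points and contain $0$, and let $I\subset\mathbb R$ be an open interval such that $\Psi$ does not agree a.e. on $I$ with any polynomial. Then $\mathcal N_1(\Psi,W,I)$ is dense in $C(\mathbb R)$ for locally uniform convergence. Moreover, for every $r\ge1$ and every $\mathcal A\subset\mathbb R^r$ such that no nonzero homogeneous polynomial in $r$ variables vanishes identically on $\mathcal A$, the space $\mathcal N_r(\Psi,W\mathcal A,I)$, where $W\mathcal A=\{wa: w\in W,\ a\in\mathcal A\}$, is dense in $C(\mathbb R^r)$ for locally uniform convergence. 3. If $\Psi$ is moreover bounded (at every point) on every compact set, then 1 and 2 also hold with "dense for locally uniform convergence" replaced by "pointwise-uniformly dense". -/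

import Mathlib

open MeasureTheory
open scoped ENNReal Pointwise

namespace ShallowNet

/-- `L^∞_loc(ℝ)`: (Lebesgue-measurable and) essentially bounded on every compact set. -/
def LocEssBounded (f : ℝ → ℝ) : Prop :=
  ∀ K : Set ℝ, IsCompact K → MemLp f ∞ (volume.restrict K)

/-- The class `M(ℝ)`: locally essentially bounded functions such that the closure of the set of
discontinuity points is Lebesgue-null. -/
def MemM (f : ℝ → ℝ) : Prop :=
  LocEssBounded f ∧ volume (closure {x : ℝ | ¬ ContinuousAt f x}) = 0

/-- Genuine boundedness (at every point) on every compact set. -/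
def LocBounded (f : ℝ → ℝ) : Prop :=
  ∀ K : Set ℝ, IsCompact K → ∃ C : ℝ, ∀ x ∈ K, |f x| ≤ C

/-- `f` agrees Lebesgue-almost everywhere on `I` with some polynomial in one variable. -/
def AEPolynomialOn (f : ℝ → ℝ) (I : Set ℝ) : Prop :=
  ∃ P : Polynomial ℝ, ∀ᵐ x ∂(volume.restrict I), f x = P.eval x

section Network

variable {E : Type*} [NormedAddCommGroup E] [InnerProductSpace ℝ E]

/-- `N(Ψ, W, Θ)`: the linear span of the functions `x ↦ Ψ (wᵀx + θ)`, `w ∈ W`, `θ ∈ Θ`. -/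
def network (Ψ : ℝ → ℝ) (W : Set E) (Θ : Set ℝ) : Submodule ℝ (E → ℝ) :=
  Submodule.span ℝ {f | ∃ w ∈ W, ∃ θ ∈ Θ, f = fun x => Ψ (inner ℝ w x + θ)}

end Network

/-- `Σ^r(Ψ) = N_r(Ψ, ℝ^r, ℝ)`. -/
noncomputable def sigmaNet (r : ℕ) (Ψ : ℝ → ℝ) : Submodule ℝ (EuclideanSpace ℝ (Fin r) → ℝ) :=
  network Ψ Set.univ Set.univ

/-- Density in `C(E)` for locally uniform convergence, where functions are identified when they
agree almost everywhere: on every nonempty compact set `K`, every continuous function on `K` is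
approximated arbitrarily well by members of `S` in the norm of `L^∞(K)`. -/
def EssDense {E : Type*} [TopologicalSpace E] [MeasureSpace E] (S : Set (E → ℝ)) : Prop :=
  ∀ K : Set E, IsCompact K → K.Nonempty → ∀ g : C(K, ℝ), ∀ ε : ℝ, 0 < ε →
    ∃ f ∈ S, ∀ᵐ x : E, ∀ hx : x ∈ K, |f x - g ⟨x, hx⟩| < ε

/-- Density in `C(E)` for locally uniform convergence, with the supremum over all points: on every
nonempty compact set `K`, every continuous function on `K` is uniformly approximated by members
of `S`. -/
def UnifDense {E : Type*} [TopologicalSpace E] (S : Set (E → ℝ)) : Prop :=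
  ∀ K : Set E, IsCompact K → K.Nonempty → ∀ g : C(K, ℝ), ∀ ε : ℝ, 0 < ε →
    ∃ f ∈ S, ∀ x : K, |f x - g x| < ε

/-- No nontrivial homogeneous polynomial in `r` variables vanishes identically on `A`. -/
def NoHomogeneousVanishing {r : ℕ} (A : Set (EuclideanSpace ℝ (Fin r))) : Prop :=
  ∀ (k : ℕ) (p : MvPolynomial (Fin r) ℝ), p.IsHomogeneous k →
    (∀ a ∈ A, MvPolynomial.eval (fun i => a i) p = 0) → p = 0

end ShallowNet

namespace ShallowNet

open Filter Topology
open scoped Convolution ContDiff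

/-! Suppose first that `Ψ` is locally bounded. A mollification of `Ψ` is an average of its
translates, and since `Ψ` is a.e. continuous the Riemann sums of this average converge uniformly for
bounded arguments (`riemann_sum_uniform`). Smooth activations thus lie in the uniform closure of the
network. Differentiating `k` times in the weight at `0`, along `W`, yields `v ^ k` times a `k`-th
derivative at `θ` (`pow_mul_iteratedDeriv_mem`). If for some `k` this derivative vanished for all
mollifiers and all admissible `θ`, the mollifications would be polynomials of bounded degree, and so
would their a.e. limit `Ψ` (`aePolynomialOn_of_iteratedDeriv_mollify`). Otherwise every power `v ^
k` is available; duality turns powers of linear forms into monomials (`monomial_mem_of_pow_mem`),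
and Stone–Weierstrass gives density.

A general `Ψ` is a.e. equal to a locally bounded representative. This alters units with nonzero
weight only on null sets, so the density results are proved with zero weights removed.

Conversely, if `Ψ` is a.e. a polynomial of degree below `n`, an `n`-th difference in a fixed
direction kills every network function a.e., but sends the `n`-th power of a coordinate to `n!`. -/

/-! ### Uniform closures, monomials and Stone–Weierstrass -/

/-- The functions that are uniform limits on `K` of members of the subspace `S`. -/
def uniformClosureOn {E : Type*} (S : Submodule ℝ (E → ℝ)) (K : Set E) :
    Submodule ℝ (E → ℝ) where
  carrier := {f | ∀ ε : ℝ, 0 < ε → ∃ s ∈ S, ∀ x ∈ K, |s x - f x| < ε}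
  zero_mem' := fun ε hε => ⟨0, S.zero_mem, fun x _ => by simpa using hε⟩
  add_mem' := by
    intro f g hf hg ε hε
    obtain ⟨s, hs, hs'⟩ := hf (ε / 2) (by positivity)
    obtain ⟨t, ht, ht'⟩ := hg (ε / 2) (by positivity)
    refine ⟨s + t, S.add_mem hs ht, fun x hx => ?_⟩
    have h1 := hs' x hx
    have h2 := ht' x hx
    simp only [Pi.add_apply, abs_lt] at *
    constructor <;> linarith
  smul_mem' := by
    intro c f hf ε hε
    obtain ⟨s, hs, hs'⟩ := hf (ε / (|c| + 1)) (by positivity)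
    refine ⟨c • s, S.smul_mem c hs, fun x hx => ?_⟩
    have h1 := hs' x hx
    rw [lt_div_iff₀ (by positivity)] at h1
    simp only [Pi.smul_apply, smul_eq_mul, ← mul_sub, abs_mul]
    nlinarith [abs_nonneg (s x - f x)]

theorem mem_uniformClosureOn_of_approx {E : Type*} {S : Submodule ℝ (E → ℝ)} {K : Set E}
    {f : E → ℝ}
    (h : ∀ ε : ℝ, 0 < ε → ∃ g ∈ uniformClosureOn S K, ∀ x ∈ K, |g x - f x| < ε) :
    f ∈ uniformClosureOn S K := by
  intro ε hε
  obtain ⟨g, hg, hgf⟩ := h (ε / 2) (by positivity)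
  obtain ⟨s, hs, hsg⟩ := hg (ε / 2) (by positivity)
  refine ⟨s, hs, fun x hx => ?_⟩
  have h1 := hgf x hx
  have h2 := hsg x hx
  rw [abs_lt] at *
  constructor <;> linarith

/-- A space whose uniform closure on every compact set contains all monomials in a separating
family of continuous functions is dense. -/
theorem unifDense_of_monomials {E ι : Type*} [TopologicalSpace E] (S : Submodule ℝ (E → ℝ))
    (c : ι → E → ℝ) (hc : ∀ i, Continuous (c i)) (hsep : ∀ x y, (∀ i, c i x = c i y) → x = y)
    (h : ∀ K : Set E, IsCompact K → ∀ d : ι →₀ ℕ,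
      (fun x => ∏ i ∈ d.support, c i x ^ d i) ∈ uniformClosureOn S K) :
    UnifDense (S : Set (E → ℝ)) := by
  intro K hK _ g ε hε
  have : CompactSpace K := isCompact_iff_compactSpace.mp hK
  let C : ι → C(K, ℝ) := fun i => ⟨fun x => c i x, (hc i).comp continuous_subtype_val⟩
  have hA : (Algebra.adjoin ℝ (Set.range C)).SeparatesPoints := by
    intro x y hxy
    have : ∃ i, c i x ≠ c i y := by
      by_contra! hcon
      exact hxy (Subtype.ext (hsep _ _ hcon))
    obtain ⟨i, hi⟩ := this
    exact ⟨C i, ⟨C i, Algebra.subset_adjoin ⟨i, rfl⟩, rfl⟩, hi⟩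
  obtain ⟨⟨p, hp⟩, hpg⟩ :=
    ContinuousMap.exists_mem_subalgebra_near_continuousMap_of_separatesPoints _ hA g (ε / 2)
      (by positivity)
  rw [Algebra.adjoin_range_eq_range_aeval] at hp
  obtain ⟨P, rfl⟩ := hp
  have hmem : (fun x => MvPolynomial.eval (fun i => c i x) P) ∈ uniformClosureOn S K := by
    have : (fun x => MvPolynomial.eval (fun i => c i x) P) =
        ∑ d ∈ P.support, P.coeff d • fun x => ∏ i ∈ d.support, c i x ^ d i := by
      ext x
      simp [MvPolynomial.eval_eq, Finset.sum_apply]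
    rw [this]
    exact Submodule.sum_mem _ fun d _ => Submodule.smul_mem _ _ (h K hK d)
  obtain ⟨s, hs, hsP⟩ := hmem (ε / 2) (by positivity)
  refine ⟨s, hs, fun x => ?_⟩
  have h1 := hsP x x.2
  have h2 := ((MvPolynomial.aeval C P - g).norm_coe_le_norm x).trans_lt hpg
  have h3 : (MvPolynomial.aeval C P) x = MvPolynomial.eval (fun i => c i x) P := by
    simp [MvPolynomial.aeval_def, MvPolynomial.eval₂_eq, MvPolynomial.eval_eq, C,
      ContinuousMap.sum_apply, ContinuousMap.prod_apply]
  rw [ContinuousMap.sub_apply, h3, Real.norm_eq_abs] at h2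
  rw [abs_lt] at *
  constructor <;> linarith

/-- If no nonzero homogeneous polynomial vanishes on `A`, a subspace containing all powers of the
linear forms with coefficients in `A` contains all monomials. -/
theorem monomial_mem_of_pow_mem {r : ℕ} {A : Set (EuclideanSpace ℝ (Fin r))}
    (hA : NoHomogeneousVanishing A) (V : Submodule ℝ (EuclideanSpace ℝ (Fin r) → ℝ))
    (hV : ∀ a ∈ A, ∀ k : ℕ, (fun x => (inner ℝ a x : ℝ) ^ k) ∈ V) (d : Fin r →₀ ℕ) :
    (fun x : EuclideanSpace ℝ (Fin r) => ∏ i ∈ d.support, x i ^ d i) ∈ V := by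
  by_contra hcon
  obtain ⟨l, hl, hker⟩ := Submodule.exists_le_ker_of_notMem hcon
  set n := d.degree with hn
  let m : (Fin r → ℕ) → (EuclideanSpace ℝ (Fin r) → ℝ) := fun e x => ∏ i, x i ^ e i
  let T := Finset.piAntidiag (Finset.univ : Finset (Fin r)) n
  let F : (Fin r → ℕ) → (Fin r →₀ ℕ) := Finsupp.equivFunOnFinite.symm
  -- By the multinomial theorem `q` evaluated at `a` is `l` applied to the `n`-th power of the
  -- linear form of `a`. It vanishes on `A`, while its coefficient at `d` is a nonzero multiple of
  -- `l (m d)`.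
  let q : MvPolynomial (Fin r) ℝ :=
    ∑ e ∈ T, MvPolynomial.monomial (F e) ((Nat.multinomial Finset.univ e : ℝ) * l (m e))
  have hq : q = 0 := by
    refine hA n q (MvPolynomial.IsHomogeneous.sum _ _ _ fun e he => ?_) fun a ha => ?_
    · refine MvPolynomial.isHomogeneous_monomial _ ?_
      rw [Finset.mem_piAntidiag] at he
      rw [← he.1, Finsupp.degree_eq_sum]
      rfl
    · have h0 := hker (hV a ha n)
      have hpow : (fun x => (inner ℝ a x : ℝ) ^ n) =
          ∑ e ∈ T, ((Nat.multinomial Finset.univ e : ℝ) * ∏ i, a i ^ e i) • m e := by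
        ext x
        rw [PiLp.inner_apply, Finset.sum_pow_eq_sum_piAntidiag, Finset.sum_apply]
        refine Finset.sum_congr rfl fun e _ => ?_
        simp only [m, Pi.smul_apply, smul_eq_mul, RCLike.inner_apply, conj_trivial, mul_pow,
          Finset.prod_mul_distrib]
        ring
      rw [LinearMap.mem_ker, hpow, map_sum] at h0
      rw [← h0, map_sum]
      refine Finset.sum_congr rfl fun e _ => ?_
      rw [MvPolynomial.eval_monomial, map_smul, smul_eq_mul, Finsupp.prod_fintype _ _ (by simp)]
      simp only [F, Finsupp.equivFunOnFinite_symm_apply_apply]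
      ring
  have hc : q.coeff d = (Nat.multinomial Finset.univ d : ℝ) * l (m d) := by
    have hdT : ⇑d ∈ T := by
      rw [Finset.mem_piAntidiag]
      exact ⟨by rw [hn, Finsupp.degree_eq_sum], by simp⟩
    rw [MvPolynomial.coeff_sum, Finset.sum_eq_single_of_mem _ hdT]
    · rw [MvPolynomial.coeff_monomial, if_pos]
      ext i; rfl
    · intro e _ hne
      rw [MvPolynomial.coeff_monomial, if_neg]
      rintro rfl
      exact hne rfl
  rw [hq, MvPolynomial.coeff_zero] at hc
  have hm : m d = fun x : EuclideanSpace ℝ (Fin r) => ∏ i ∈ d.support, x i ^ d i := by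
    ext x
    exact (Finsupp.prod_fintype d (fun i k => x i ^ k) (by simp)).symm
  rw [hm] at hc
  rcases mul_eq_zero.mp hc.symm with h | h
  · exact (Nat.multinomial_pos _ _).ne' (by exact_mod_cast h)
  · exact hl h

/-! ### Riemann sums of translates -/

theorem MemM.locallyIntegrable {Ψ : ℝ → ℝ} (hΨ : MemM Ψ) : LocallyIntegrable Ψ := by
  rw [locallyIntegrable_iff]
  intro K hK
  have : IsFiniteMeasure (volume.restrict K) := ⟨by simpa using hK.measure_lt_top⟩
  exact (hΨ.1 K hK).integrable le_top

theorem MemM.ae_continuousAt {Ψ : ℝ → ℝ} (hΨ : MemM Ψ) : ∀ᵐ x, ContinuousAt Ψ x :=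
  measure_mono_null subset_closure hΨ.2

theorem floor_mul_div_bounds (N : ℕ) (s : ℝ) :
    ⌊(N + 1 : ℝ) * s⌋ / (N + 1 : ℝ) ≤ s ∧
      s - 1 / (N + 1 : ℝ) ≤ ⌊(N + 1 : ℝ) * s⌋ / (N + 1 : ℝ) := by
  have hN : (0 : ℝ) < N + 1 := by positivity
  have h1 := Int.floor_le ((N + 1 : ℝ) * s)
  have h2 := Int.lt_floor_add_one ((N + 1 : ℝ) * s)
  constructor
  · rw [div_le_iff₀ hN]; linarith
  · rw [le_div_iff₀ hN, sub_mul, div_mul_cancel₀ _ hN.ne']; linarith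

/-- The function factors through the discrete space `ℤ`, so `Ψ` may be arbitrary. -/
theorem measurable_comp_floor (Ψ : ℝ → ℝ) (N : ℕ) (t : ℝ) :
    Measurable fun s : ℝ => Ψ (t + ⌊(N + 1 : ℝ) * s⌋ / (N + 1 : ℝ)) :=
  (Measurable.of_discrete (f := fun m : ℤ => Ψ (t + m / (N + 1 : ℝ)))).comp
    (Int.measurable_floor.comp (measurable_id.const_mul (N + 1 : ℝ)))

theorem integrable_mul_of_bounded_on {F η : ℝ → ℝ} (hη : Continuous η) {c d M : ℝ}
    (hsupp : Function.support η ⊆ Set.Icc c d) (hF : AEStronglyMeasurable F)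
    (hM : ∀ s ∈ Set.Icc c d, |F s| ≤ M) : Integrable fun s => F s * η s := by
  have hηi : Integrable η :=
    hη.integrable_of_hasCompactSupport
      (HasCompactSupport.of_support_subset_isCompact isCompact_Icc hsupp)
  refine Integrable.mono' (hηi.norm.const_mul M) (hF.mul hη.aestronglyMeasurable)
    (Eventually.of_forall fun s => ?_)
  by_cases hs : s ∈ Set.Icc c d
  · rw [norm_mul]
    exact mul_le_mul_of_nonneg_right (hM s hs) (norm_nonneg _)
  · have : η s = 0 := by
      by_contra h
      exact hs (hsupp h)
    simp [this]

/-- A continuous compactly supported average of translates of `Ψ` is, locally uniformly in the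
translation parameter, a limit of Riemann sums. -/
theorem riemann_sum_uniform {Ψ η : ℝ → ℝ} (hΨ : MemM Ψ) (hb : LocBounded Ψ)
    (hη : Continuous η) {c d : ℝ} (hsupp : Function.support η ⊆ Set.Icc c d) (R : ℝ) {ε : ℝ}
    (hε : 0 < ε) :
    ∃ N₀ : ℕ, ∀ N : ℕ, N₀ ≤ N → ∀ t : ℝ, |t| ≤ R →
      |(∫ s, Ψ (t + ⌊(N + 1 : ℝ) * s⌋ / (N + 1 : ℝ)) * η s) - ∫ s, Ψ (t + s) * η s| < ε := by
  -- Uniformity in `t` is obtained by contradiction, from a sequence of bad parameters `t n` with `N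
  -- n ≥ n`.
  by_contra! hcon
  choose N hN t ht hbad using hcon
  -- The extra `1` leaves room for nodes, which lie up to `1 / (N + 1)` to the left of `s`.
  obtain ⟨M, hM⟩ := hb (Set.Icc (c - R - 1) (d + R)) isCompact_Icc
  obtain ⟨H, hH⟩ : ∃ H, ∀ s, |η s| ≤ H :=
    (HasCompactSupport.of_support_subset_isCompact isCompact_Icc hsupp).exists_bound_of_continuous hη
  have hη0 : ∀ s, s ∉ Set.Icc c d → η s = 0 := fun s hs => by
    by_contra h
    exact hs (hsupp h)
  have hN1 : ∀ n, 1 / ((N n : ℝ) + 1) ≤ 1 := fun n => by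
    rw [div_le_one (by positivity)]; linarith [Nat.cast_nonneg (α := ℝ) (N n)]
  let ρ : ℕ → ℝ → ℝ := fun n s => ⌊((N n : ℝ) + 1) * s⌋ / ((N n : ℝ) + 1)
  have hρ : ∀ n s, ρ n s ≤ s ∧ s - 1 / ((N n : ℝ) + 1) ≤ ρ n s := fun n s =>
    floor_mul_div_bounds (N n) s
  have hM1 : ∀ n, ∀ s ∈ Set.Icc c d, |Ψ (t n + ρ n s)| ≤ M := fun n s hs => by
    have h1 := abs_le.mp (ht n)
    have h2 := hρ n s
    have h3 := hN1 n
    exact hM _ ⟨by linarith [hs.1], by linarith [hs.2]⟩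
  have hM2 : ∀ n, ∀ s ∈ Set.Icc c d, |Ψ (t n + s)| ≤ M := fun n s hs => by
    have h1 := abs_le.mp (ht n)
    exact hM _ ⟨by linarith [hs.1], by linarith [hs.2]⟩
  have hmeas : AEStronglyMeasurable Ψ := hΨ.locallyIntegrable.aestronglyMeasurable
  have hmeas1 : ∀ n, AEStronglyMeasurable fun s => Ψ (t n + ρ n s) := fun n =>
    (measurable_comp_floor Ψ (N n) (t n)).aestronglyMeasurable
  have hmeas2 : ∀ n, AEStronglyMeasurable fun s => Ψ (t n + s) := fun n =>
    hmeas.comp_measurePreserving (measurePreserving_add_left volume (t n))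
  -- In the variable `u = t n + s` the comparison value `Ψ u` no longer depends on `n`. Dominated
  -- convergence then needs only continuity at almost every `u`, and no convergence of `t n`.
  let G : ℕ → ℝ → ℝ := fun n u => (Ψ (t n + ρ n (-t n + u)) - Ψ u) * η (-t n + u)
  have hG : ∀ n, ε ≤ |∫ u, G n u| := fun n => by
    refine (hbad n).trans_eq ?_
    rw [← integral_sub (integrable_mul_of_bounded_on hη hsupp (hmeas1 n) (hM1 n))
      (integrable_mul_of_bounded_on hη hsupp (hmeas2 n) (hM2 n)),
      ← integral_add_left_eq_self (G n) (t n)]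
    congr 2 with s
    simp only [G, neg_add_cancel_left, ρ]
    ring
  have hH0 : 0 ≤ H := (abs_nonneg _).trans (hH 0)
  have hlim : Tendsto (fun n => ∫ u, G n u) atTop (𝓝 (∫ _ : ℝ, (0 : ℝ))) := by
    refine tendsto_integral_of_dominated_convergence
      ((Set.Icc (c - R) (d + R)).indicator fun _ => 2 * M * H) (fun n => ?_) ?_ (fun n => ?_) ?_
    · refine AEStronglyMeasurable.mul (AEStronglyMeasurable.sub ?_ hmeas) ?_
      · exact (hmeas1 n).comp_measurePreserving (measurePreserving_add_left volume (-t n))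
      · exact (hη.comp (continuous_const.add continuous_id)).aestronglyMeasurable
    · exact (integrable_indicator_iff measurableSet_Icc).mpr
        (integrableOn_const measure_Icc_lt_top.ne)
    · refine Eventually.of_forall fun u => ?_
      have h1 := abs_le.mp (ht n)
      by_cases hs : -t n + u ∈ Set.Icc c d
      · have hu : u ∈ Set.Icc (c - R) (d + R) := ⟨by linarith [hs.1], by linarith [hs.2]⟩
        rw [Set.indicator_of_mem hu, norm_mul]
        have h2 := hM1 n _ hs
        have h3 := hM2 n _ hs
        rw [add_neg_cancel_left] at h3
        have h4 : ‖Ψ (t n + ρ n (-t n + u)) - Ψ u‖ ≤ 2 * M := by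
          refine (norm_sub_le _ _).trans ?_
          simp only [Real.norm_eq_abs]
          linarith
        exact mul_le_mul h4 (hH _) (norm_nonneg _) ((norm_nonneg _).trans h4)
      · simp only [G, hη0 _ hs, mul_zero, norm_zero]
        refine Set.indicator_nonneg (fun x hx => ?_) u
        have : 0 ≤ M := (abs_nonneg _).trans (hM x ⟨by linarith [hx.1], hx.2⟩)
        positivity
    · filter_upwards [hΨ.ae_continuousAt] with u hu
      have hNlim : Tendsto (fun n => 1 / ((N n : ℝ) + 1)) atTop (𝓝 0) :=
        tendsto_one_div_add_atTop_nhds_zero_nat.comp (tendsto_atTop_mono hN tendsto_id)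
      have harg : Tendsto (fun n => t n + ρ n (-t n + u)) atTop (𝓝 u) := by
        refine tendsto_of_tendsto_of_tendsto_of_le_of_le (g := fun n => u - 1 / ((N n : ℝ) + 1))
          (h := fun _ => u) (by simpa using hNlim.const_sub u) tendsto_const_nhds
          (fun n => ?_) (fun n => ?_)
        · have := (hρ n (-t n + u)).2
          simp only; linarith
        · have := (hρ n (-t n + u)).1
          simp only; linarith
      have h0 : Tendsto (fun n => |Ψ (t n + ρ n (-t n + u)) - Ψ u| * H) atTop (𝓝 0) := by
        have := (((hu.tendsto.comp harg).sub_const (Ψ u)).abs).mul_const H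
        simpa using this
      refine squeeze_zero_norm (fun n => ?_) h0
      rw [norm_mul]
      exact mul_le_mul_of_nonneg_left (hH _) (norm_nonneg _)
  rw [integral_zero] at hlim
  obtain ⟨n, hn⟩ := (hlim.abs.eventually (gt_mem_nhds (by simpa using hε))).exists
  exact absurd (hG n) (not_le.mpr hn)

/-- The Riemann sum over the cells of length `1 / (N + 1)`, written as a finite sum. -/
theorem integral_floor_eq_sum {Ψ η : ℝ → ℝ} (hη : Continuous η) {c d : ℝ}
    (hsupp : Function.support η ⊆ Set.Icc c d) (N : ℕ) :
    ∃ (T : Finset ℤ) (b : ℤ → ℝ),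
      (∀ m ∈ T, (m : ℝ) / (N + 1 : ℝ) ∈ Set.Icc (c - 1 / (N + 1 : ℝ)) d) ∧
      ∀ t : ℝ, ∫ s, Ψ (t + ⌊(N + 1 : ℝ) * s⌋ / (N + 1 : ℝ)) * η s =
        ∑ m ∈ T, b m * Ψ (t + m / (N + 1 : ℝ)) := by
  have hN : (0 : ℝ) < N + 1 := by positivity
  let J : ℤ → Set ℝ := fun m => {s | ⌊(N + 1 : ℝ) * s⌋ = m}
  have hJ : ∀ m, MeasurableSet (J m) := fun m =>
    measurableSet_eq_fun (Int.measurable_floor.comp (measurable_id.const_mul (N + 1 : ℝ)))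
      measurable_const
  have hηi : Integrable η :=
    hη.integrable_of_hasCompactSupport
      (HasCompactSupport.of_support_subset_isCompact isCompact_Icc hsupp)
  -- The floor loses less than `1`, whence the `- 1`: nodes may undershoot `c` by at most one cell.
  let T : Finset ℤ := Finset.Icc ⌈(N + 1 : ℝ) * c - 1⌉ ⌊(N + 1 : ℝ) * d⌋
  refine ⟨T, fun m => ∫ s, (J m).indicator η s, fun m hm => ?_, fun t => ?_⟩
  · rw [Finset.mem_Icc, Int.ceil_le, Int.le_floor] at hm
    constructor
    · rw [le_div_iff₀ hN, sub_mul, div_mul_cancel₀ _ hN.ne']; linarith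
    · rw [div_le_iff₀ hN]; linarith
  · have hpt : ∀ s, Ψ (t + ⌊(N + 1 : ℝ) * s⌋ / (N + 1 : ℝ)) * η s =
        ∑ m ∈ T, (J m).indicator η s * Ψ (t + m / (N + 1 : ℝ)) := by
      intro s
      by_cases hs : η s = 0
      · simp [Set.indicator_apply, hs]
      · have hsI := hsupp hs
        rw [Finset.sum_eq_single_of_mem ⌊(N + 1 : ℝ) * s⌋]
        · rw [Set.indicator_of_mem (by rfl), mul_comm]
        · rw [Finset.mem_Icc, Int.ceil_le]
          refine ⟨?_, Int.floor_le_floor (by nlinarith [hsI.2])⟩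
          have := Int.lt_floor_add_one ((N + 1 : ℝ) * s)
          nlinarith [hsI.1]
        · intro m _ hm
          rw [Set.indicator_of_notMem (fun h => hm h.symm), zero_mul]
    simp_rw [hpt]
    rw [integral_finsetSum _ fun m _ => (hηi.indicator (hJ m)).mul_const _]
    exact Finset.sum_congr rfl fun m _ => integral_mul_const _ _

/-- Averages of translates lie in the uniform closure of the network. -/
theorem integral_mem_uniformClosureOn {E : Type*} {Ψ η : ℝ → ℝ} (hΨ : MemM Ψ) (hb : LocBounded Ψ)
    (hη : Continuous η) {c d : ℝ} (hsupp : Function.support η ⊆ Set.Icc c d) {I : Set ℝ}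
    (hI : IsOpen I) (hcd : Set.Icc c d ⊆ I) (hle : c ≤ d) (S : Submodule ℝ (E → ℝ)) (u : E → ℝ)
    (hS : ∀ θ ∈ I, (fun x => Ψ (u x + θ)) ∈ S) {K : Set E} {R : ℝ} (hR : ∀ x ∈ K, |u x| ≤ R) :
    (fun x => ∫ s, Ψ (u x + s) * η s) ∈ uniformClosureOn S K := by
  intro ε hε
  obtain ⟨N₀, hN₀⟩ := riemann_sum_uniform hΨ hb hη hsupp R hε
  -- A fine enough grid keeps the nodes that undershoot `c` inside the open set `I`.
  obtain ⟨δ, hδ, hδI⟩ := Metric.isOpen_iff.mp hI c (hcd ⟨le_rfl, hle⟩)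
  obtain ⟨N₁, hN₁⟩ := exists_nat_one_div_lt hδ
  obtain ⟨T, b, hT, hsum⟩ := integral_floor_eq_sum (Ψ := Ψ) hη hsupp (max N₀ N₁)
  refine ⟨∑ m ∈ T, b m • fun x => Ψ (u x + m / ((max N₀ N₁ : ℕ) + 1 : ℝ)),
    Submodule.sum_mem _ fun m hm => Submodule.smul_mem _ _ (hS _ ?_), fun x hx => ?_⟩
  · by_cases h : c ≤ (m : ℝ) / ((max N₀ N₁ : ℕ) + 1 : ℝ)
    · exact hcd ⟨h, (hT m hm).2⟩
    · refine hδI ?_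
      have h1 := (hT m hm).1
      have h2 : 1 / ((max N₀ N₁ : ℕ) + 1 : ℝ) ≤ 1 / (N₁ + 1 : ℝ) :=
        one_div_le_one_div_of_le (by positivity) (by gcongr; exact le_max_right _ _)
      rw [Metric.mem_ball, Real.dist_eq, abs_lt]
      constructor <;> linarith
  · have := hN₀ _ (le_max_left N₀ N₁) (u x) (hR x hx)
    rw [hsum] at this
    simpa [Finset.sum_apply] using this

/-! ### Mollification and differentiation in the weight -/

/-- The mollification of `Ψ` by a normalised bump function. -/
noncomputable def mollify (ρ : ContDiffBump (0 : ℝ)) (Ψ : ℝ → ℝ) : ℝ → ℝ :=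
  ρ.normed volume ⋆[ContinuousLinearMap.lsmul ℝ ℝ, volume] Ψ

theorem mollify_contDiff (ρ : ContDiffBump (0 : ℝ)) {Ψ : ℝ → ℝ} (hΨ : LocallyIntegrable Ψ) :
    ContDiff ℝ ∞ (mollify ρ Ψ) :=
  ρ.hasCompactSupport_normed.contDiff_convolution_left _ ρ.contDiff_normed hΨ

/-- Reflecting the integration variable about `θ` moves `θ` into the kernel, leaving an average of
translates of `Ψ` as in `integral_mem_uniformClosureOn`. -/
theorem mollify_add (ρ : ContDiffBump (0 : ℝ)) (Ψ : ℝ → ℝ) (u θ : ℝ) :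
    mollify ρ Ψ (u + θ) = ∫ s, Ψ (u + s) * ρ.normed volume (θ - s) := by
  rw [mollify, convolution_def, ← integral_sub_left_eq_self _ _ θ]
  congr 1 with s
  rw [ContinuousLinearMap.lsmul_apply, smul_eq_mul, mul_comm, add_sub_assoc, sub_sub_cancel]

theorem mollify_mem_uniformClosureOn {E : Type*} {Ψ : ℝ → ℝ} (hΨ : MemM Ψ) (hb : LocBounded Ψ)
    (ρ : ContDiffBump (0 : ℝ)) {θ : ℝ} {I : Set ℝ} (hI : IsOpen I)
    (hθ : Set.Icc (θ - ρ.rOut) (θ + ρ.rOut) ⊆ I) (S : Submodule ℝ (E → ℝ)) (u : E → ℝ)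
    (hS : ∀ θ ∈ I, (fun x => Ψ (u x + θ)) ∈ S) {K : Set E} {R : ℝ} (hR : ∀ x ∈ K, |u x| ≤ R) :
    (fun x => mollify ρ Ψ (u x + θ)) ∈ uniformClosureOn S K := by
  simp_rw [mollify_add]
  refine integral_mem_uniformClosureOn hΨ hb
    (ρ.contDiff_normed (n := 0).continuous.comp (continuous_const.sub continuous_id)) ?_ hI hθ
    (by linarith [ρ.rOut_pos]) S u hS hR
  intro s hs
  have h : θ - s ∈ Function.support (ρ.normed volume) := hs
  rw [ρ.support_normed_eq, Metric.mem_ball, Real.dist_eq, sub_zero, abs_lt] at h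
  exact ⟨by linarith [h.2], by linarith [h.1]⟩

/-- Derivatives with respect to a dilation parameter, taken along any set accumulating at `0`. -/
theorem pow_mul_iteratedDeriv_mem {E : Type*} {S : Submodule ℝ (E → ℝ)} {K : Set E} {f : ℝ → ℝ}
    (hf : ContDiff ℝ ∞ f) {W : Set ℝ} (hW : AccPt 0 (𝓟 W)) {v : E → ℝ} {R θ : ℝ}
    (hR : ∀ x ∈ K, |v x| ≤ R)
    (hmem : ∀ w ∈ W, w ≠ 0 → (fun x => f (w * v x + θ)) ∈ uniformClosureOn S K) (k : ℕ) :
    (fun x => v x ^ k * iteratedDeriv k f θ) ∈ uniformClosureOn S K := by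
  induction k using Nat.strong_induction_on with
  | _ k ih =>
  -- Subtract from `f (w * v x + θ)` its Taylor terms of order below `k`, which are in the closure
  -- by induction, and rescale by `k! / w ^ k`. The result tends uniformly to the required function
  -- as `w → 0` in `W`.
  refine mem_uniformClosureOn_of_approx fun ε hε => ?_
  have hT := taylor_isLittleO_univ (x₀ := θ) (n := k) (hf.of_le (by exact_mod_cast le_top))
  have hk : (0 : ℝ) < k.factorial := by exact_mod_cast k.factorial_pos
  -- Chosen so that the Taylor error, after rescaling and with `|v x| ≤ |R|`, is at most `ε / 2`.
  have hη : 0 < ε / (2 * k.factorial * (|R| ^ k + 1)) := by positivity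
  obtain ⟨δ, hδ, hball⟩ := Metric.eventually_nhds_iff.mp (hT.def hη)
  obtain ⟨w, ⟨hwδ, hwW⟩, hw0⟩ :=
    accPt_iff_nhds.mp hW (Metric.ball 0 (δ / (|R| + 1))) (Metric.ball_mem_nhds _ (by positivity))
  rw [Metric.mem_ball, Real.dist_eq, sub_zero, lt_div_iff₀ (by positivity)] at hwδ
  refine ⟨(k.factorial / w ^ k) • ((fun x => f (w * v x + θ)) - ∑ j ∈ Finset.range k,
    (w ^ j / j.factorial) • fun x => v x ^ j * iteratedDeriv j f θ), Submodule.smul_mem _ _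
      (Submodule.sub_mem _ (hmem w hwW hw0) (Submodule.sum_mem _ fun j hj =>
        Submodule.smul_mem _ _ (ih j (Finset.mem_range.mp hj)))), fun x hx => ?_⟩
  have hvR : |v x| ≤ |R| := (hR x hx).trans (le_abs_self R)
  have hd : dist (w * v x + θ) θ < δ := by
    rw [Real.dist_eq, add_sub_cancel_right, abs_mul]
    nlinarith [abs_nonneg w, abs_pos.mpr hw0]
  have h1 := hball hd
  rw [taylor_within_apply, Finset.sum_range_succ] at h1
  simp only [iteratedDerivWithin_univ, add_sub_cancel_right, smul_eq_mul, norm_pow, norm_mul,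
    Real.norm_eq_abs] at h1
  have hwk : w ^ k ≠ 0 := pow_ne_zero _ hw0
  have hexp : ((k.factorial / w ^ k) • ((fun x => f (w * v x + θ)) - ∑ j ∈ Finset.range k,
      (w ^ j / j.factorial) • fun x => v x ^ j * iteratedDeriv j f θ)) x -
        v x ^ k * iteratedDeriv k f θ =
      (k.factorial / w ^ k) * (f (w * v x + θ) - (∑ j ∈ Finset.range k,
        ((j.factorial : ℝ)⁻¹ * (w * v x) ^ j) * iteratedDeriv j f θ +
          ((k.factorial : ℝ)⁻¹ * (w * v x) ^ k) * iteratedDeriv k f θ)) := by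
    have hs : ∑ j ∈ Finset.range k, ((j.factorial : ℝ)⁻¹ * (w * v x) ^ j) * iteratedDeriv j f θ =
        ∑ j ∈ Finset.range k, (w ^ j / j.factorial) * (v x ^ j * iteratedDeriv j f θ) :=
      Finset.sum_congr rfl fun j _ => by rw [mul_pow]; ring
    rw [hs]
    simp only [Pi.smul_apply, Pi.sub_apply, Finset.sum_apply, smul_eq_mul, mul_pow]
    field_simp
    ring
  rw [hexp, abs_mul, abs_div, abs_of_pos hk, abs_pow]
  have hwk' : 0 < |w| ^ k := pow_pos (abs_pos.mpr hw0) k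
  calc (k.factorial / |w| ^ k) * _
      ≤ (k.factorial / |w| ^ k) * (ε / (2 * k.factorial * (|R| ^ k + 1)) * (|w| * |v x|) ^ k) := by
        gcongr
    _ = ε / 2 * (|v x| ^ k / (|R| ^ k + 1)) := by
        rw [mul_pow]; field_simp
    _ ≤ ε / 2 * 1 := by
        gcongr
        rw [div_le_one (by positivity)]
        have := pow_le_pow_left₀ (abs_nonneg _) hvR k
        linarith
    _ < ε := by linarith

/-! ### Recognising polynomials through their mollifications -/

/-- The polynomial is the Taylor polynomial of order `k`; its Lagrange remainder contains the
derivative of order `k + 1`, which vanishes too. The degree bound is one above the sharp one, which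
only costs one more interpolation node later. -/
theorem exists_polynomial_of_iteratedDeriv_eq_zero {f : ℝ → ℝ} (hf : ContDiff ℝ ∞ f) {k : ℕ}
    {a b : ℝ} (h : ∀ x ∈ Set.Ioo a b, iteratedDeriv k f x = 0) :
    ∃ P : Polynomial ℝ, P.degree < (k + 1 : ℕ) ∧ ∀ x ∈ Set.Ioo a b, f x = P.eval x := by
  rcases le_or_gt b a with hab | hab
  · exact ⟨0, by simp [WithBot.bot_lt_iff_ne_bot], fun x hx => absurd hx (by simp [hab])⟩
  obtain ⟨c, hc⟩ := Set.nonempty_Ioo.mpr hab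
  have h' : ∀ x ∈ Set.Ioo a b, iteratedDeriv (k + 1) f x = 0 := by
    intro x hx
    rw [iteratedDeriv_succ]
    have : iteratedDeriv k f =ᶠ[𝓝 x] fun _ => 0 :=
      Filter.eventuallyEq_of_mem (isOpen_Ioo.mem_nhds hx) h
    rw [this.deriv_eq, deriv_const]
  refine ⟨∑ j ∈ Finset.range (k + 1), Polynomial.C ((j.factorial : ℝ)⁻¹ * iteratedDeriv j f c) *
    (Polynomial.X - Polynomial.C c) ^ j, ?_, fun x hx => ?_⟩
  · refine lt_of_le_of_lt (Polynomial.degree_sum_le _ _) ?_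
    rw [Finset.sup_lt_iff (WithBot.bot_lt_coe _)]
    intro j hj
    rw [Polynomial.C_mul']
    refine lt_of_le_of_lt (Polynomial.degree_smul_le _ _) ?_
    rw [Polynomial.degree_pow, Polynomial.degree_X_sub_C, nsmul_one]
    exact_mod_cast Finset.mem_range.mp hj
  · rcases eq_or_ne c x with rfl | hne
    · rw [Polynomial.eval_finsetSum, Finset.sum_range_succ']
      simp
    · obtain ⟨y, hy, hyT⟩ := taylor_mean_remainder_lagrange_iteratedDeriv (n := k) hne
        (hf.of_le (by exact_mod_cast le_top)).contDiffOn
      have hyI : y ∈ Set.Ioo a b := by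
        have := Set.ordConnected_Ioo.uIcc_subset hc hx (Set.uIoo_subset_uIcc_self hy)
        exact this
      rw [h' y hyI, zero_mul, zero_div, sub_eq_zero, taylor_within_apply] at hyT
      rw [hyT, Polynomial.eval_finsetSum]
      refine Finset.sum_congr rfl fun j _ => ?_
      rw [iteratedDerivWithin_eq_iteratedDeriv (uniqueDiffOn_uIcc hne)
        (hf.of_le (by exact_mod_cast le_top)).contDiffAt Set.left_mem_uIcc]
      simp
      ring

theorem tendsto_mollify {Ψ : ℝ → ℝ} (hΨ : LocallyIntegrable Ψ) {ρ : ℕ → ContDiffBump (0 : ℝ)}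
    (hρ : Tendsto (fun n => (ρ n).rOut) atTop (𝓝 0)) {x : ℝ} (hx : ContinuousAt Ψ x) :
    Tendsto (fun n => mollify (ρ n) Ψ x) atTop (𝓝 (Ψ x)) :=
  ContDiffBump.convolution_tendsto_right (g := fun _ => Ψ) (k := fun _ => x) hρ
    (Eventually.of_forall fun _ => hΨ.aestronglyMeasurable) (hx.tendsto.comp tendsto_snd)
    tendsto_const_nhds

/-- If a fixed derivative of all mollifications of `Ψ` vanishes, then `Ψ` is a polynomial. -/
theorem aePolynomialOn_of_iteratedDeriv_mollify {Ψ : ℝ → ℝ} (hΨ : MemM Ψ) {I : Set ℝ}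
    (hI : IsOpen I) (hIc : I.OrdConnected) (k : ℕ)
    (h : ∀ (ρ : ContDiffBump (0 : ℝ)) (θ : ℝ), Set.Icc (θ - ρ.rOut) (θ + ρ.rOut) ⊆ I →
      iteratedDeriv k (mollify ρ Ψ) θ = 0) :
    AEPolynomialOn Ψ I := by
  rcases I.eq_empty_or_nonempty with rfl | hne
  · exact ⟨0, by simp⟩
  have hinf : {x ∈ I | ContinuousAt Ψ x}.Infinite := by
    intro hfin
    have h0 : volume I = 0 := by
      refine measure_mono_null (t := {x ∈ I | ContinuousAt Ψ x} ∪ {x | ¬ ContinuousAt Ψ x})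
        (fun x hx => ?_) (measure_union_null (hfin.measure_zero _) hΨ.ae_continuousAt)
      by_cases hc : ContinuousAt Ψ x
      · exact Or.inl ⟨hx, hc⟩
      · exact Or.inr hc
    exact (hI.measure_pos volume hne).ne' h0
  obtain ⟨t, ht, htc⟩ := hinf.exists_subset_card_eq (k + 1)
  -- The candidate interpolates `Ψ` at `k + 1` continuity points, where the mollifications converge
  -- to `Ψ`.
  refine ⟨Lagrange.interpolate t id Ψ, ?_⟩
  rw [ae_restrict_iff' hI.measurableSet]
  filter_upwards [hΨ.ae_continuousAt] with x hxc hxI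
  let T := insert x t
  have hT : T.Nonempty := ⟨x, Finset.mem_insert_self _ _⟩
  have hTI : ∀ y ∈ T, y ∈ I := by
    intro y hy
    rcases Finset.mem_insert.mp hy with rfl | hy
    · exact hxI
    · exact (ht hy).1
  obtain ⟨δ₁, hδ₁, hb₁⟩ := Metric.isOpen_iff.mp hI _ (hTI _ (T.min'_mem hT))
  obtain ⟨δ₂, hδ₂, hb₂⟩ := Metric.isOpen_iff.mp hI _ (hTI _ (T.max'_mem hT))
  -- One `δ` puts the nodes inside an open interval, the other accommodates the mollifier radius.
  obtain ⟨δ, hδ, hδ₁', hδ₂'⟩ : ∃ δ > 0, 2 * δ < δ₁ ∧ 2 * δ < δ₂ :=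
    ⟨min δ₁ δ₂ / 4, by positivity, by linarith [min_le_left δ₁ δ₂],
      by linarith [min_le_right δ₁ δ₂]⟩
  set a := T.min' hT
  set b := T.max' hT
  have hab : Set.Icc (a - 2 * δ) (b + 2 * δ) ⊆ I := by
    refine hIc.out (hb₁ ?_) (hb₂ ?_) <;>
    · rw [Metric.mem_ball, Real.dist_eq, abs_lt]
      constructor <;> linarith
  let ρ : ℕ → ContDiffBump (0 : ℝ) := fun n =>
    ⟨δ * (1 / ((n : ℝ) + 1)) / 2, δ * (1 / ((n : ℝ) + 1)), by positivity,
      half_lt_self (by positivity)⟩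
  have hρle : ∀ n, (ρ n).rOut ≤ δ := fun n => by
    have : 1 / ((n : ℝ) + 1) ≤ 1 := by
      rw [div_le_one (by positivity)]; linarith [Nat.cast_nonneg (α := ℝ) n]
    change δ * (1 / ((n : ℝ) + 1)) ≤ δ
    nlinarith
  have hρ : Tendsto (fun n => (ρ n).rOut) atTop (𝓝 0) := by
    have := (tendsto_one_div_add_atTop_nhds_zero_nat (𝕜 := ℝ)).const_mul δ
    rwa [mul_zero] at this
  have hmem : ∀ y ∈ T, y ∈ Set.Ioo (a - δ) (b + δ) := fun y hy =>
    ⟨by linarith [T.min'_le y hy], by linarith [T.le_max' y hy]⟩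
  -- Each mollification equals its own interpolant at the nodes; this identity passes to the limit.
  have heq : ∀ n, mollify (ρ n) Ψ x =
      ∑ i ∈ t, mollify (ρ n) Ψ i * (Lagrange.basis t id i).eval x := by
    intro n
    obtain ⟨P, hdeg, hP⟩ := exists_polynomial_of_iteratedDeriv_eq_zero
      (mollify_contDiff (ρ n) hΨ.locallyIntegrable) (k := k) (a := a - δ) (b := b + δ)
      fun θ hθ => h (ρ n) θ (subset_trans (Set.Icc_subset_Icc
        (by linarith [hθ.1, hρle n]) (by linarith [hθ.2, hρle n])) hab)
    rw [hP x (hmem x (Finset.mem_insert_self _ _)),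
      Lagrange.eq_interpolate_of_eval_eq (r := mollify (ρ n) Ψ) (v := id) (s := t)
        Function.injective_id.injOn (by rwa [htc])
        fun i hi => (hP i (hmem i (Finset.mem_insert_of_mem hi))).symm]
    simp [Lagrange.interpolate_apply, Polynomial.eval_finsetSum]
  have hl := tendsto_mollify hΨ.locallyIntegrable hρ hxc
  simp_rw [heq] at hl
  have hr : Tendsto (fun n => ∑ i ∈ t, mollify (ρ n) Ψ i * (Lagrange.basis t id i).eval x) atTop
      (𝓝 (∑ i ∈ t, Ψ i * (Lagrange.basis t id i).eval x)) :=
    tendsto_finsetSum _ fun i hi =>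
      (tendsto_mollify hΨ.locallyIntegrable hρ (ht hi).2).mul_const _
  rw [tendsto_nhds_unique hl hr]
  simp [Lagrange.interpolate_apply, Polynomial.eval_finsetSum]

/-! ### Pointwise-uniform density -/

/-- The uniform closure of a space of ridge functions contains all powers of the ridge. -/
theorem pow_mem_uniformClosureOn {E : Type*} {Ψ : ℝ → ℝ} (hΨ : MemM Ψ) (hb : LocBounded Ψ)
    {I : Set ℝ} (hI : IsOpen I) (hIc : I.OrdConnected) (hP : ¬ AEPolynomialOn Ψ I) {W : Set ℝ}
    (hW : AccPt 0 (𝓟 W)) (S : Submodule ℝ (E → ℝ)) (v : E → ℝ)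
    (hS : ∀ w ∈ W, w ≠ 0 → ∀ θ ∈ I, (fun x => Ψ (w * v x + θ)) ∈ S) {K : Set E} {R : ℝ}
    (hR : ∀ x ∈ K, |v x| ≤ R) (k : ℕ) :
    (fun x => v x ^ k) ∈ uniformClosureOn S K := by
  have hex : ∃ (ρ : ContDiffBump (0 : ℝ)) (θ : ℝ), Set.Icc (θ - ρ.rOut) (θ + ρ.rOut) ⊆ I ∧
      iteratedDeriv k (mollify ρ Ψ) θ ≠ 0 := by
    by_contra! hcon
    exact hP (aePolynomialOn_of_iteratedDeriv_mollify hΨ hI hIc k hcon)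
  obtain ⟨ρ, θ, hθ, hne⟩ := hex
  have hmem := pow_mul_iteratedDeriv_mem (θ := θ) (mollify_contDiff ρ hΨ.locallyIntegrable) hW hR
    (fun w hw hw0 => mollify_mem_uniformClosureOn hΨ hb ρ hI hθ S (fun x => w * v x)
      (hS w hw hw0) (R := |w| * R) fun x hx => by
        rw [abs_mul]; exact mul_le_mul_of_nonneg_left (hR x hx) (abs_nonneg _)) k
  have := Submodule.smul_mem _ (iteratedDeriv k (mollify ρ Ψ) θ)⁻¹ hmem
  convert this using 1
  ext x
  simp only [Pi.smul_apply, smul_eq_mul]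
  field_simp

theorem exists_abs_inner_le {E : Type*} [NormedAddCommGroup E] [InnerProductSpace ℝ E] {K : Set E}
    (hK : IsCompact K) (a : E) : ∃ R, ∀ x ∈ K, |(inner ℝ a x : ℝ)| ≤ R :=
  hK.exists_bound_of_continuousOn (f := fun x => (inner ℝ a x : ℝ)) (by fun_prop)

/-- The weight `0` is left out because its units are the constants `Ψ θ`, which a change of `Ψ` on a
null set can alter everywhere. -/
theorem unifDense_network_real {Ψ : ℝ → ℝ} (hΨ : MemM Ψ) (hb : LocBounded Ψ) {W I : Set ℝ}
    (hW : AccPt 0 (𝓟 W)) (hI : IsOpen I) (hIc : I.OrdConnected) (hP : ¬ AEPolynomialOn Ψ I) :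
    UnifDense (network Ψ (W \ {0}) I : Set (ℝ → ℝ)) := by
  refine unifDense_of_monomials _ (fun _ : Unit => id) (fun _ => continuous_id)
    (fun x y h => h ()) fun K hK d => ?_
  obtain ⟨R, hR⟩ := exists_abs_inner_le hK (1 : ℝ)
  have hmem := pow_mem_uniformClosureOn hΨ hb hI hIc hP hW (network Ψ (W \ {0}) I)
    (fun x => x) (fun w hw hw0 θ hθ => Submodule.subset_span ⟨w, ⟨hw, hw0⟩, θ, hθ, ?_⟩)
    (K := K) (R := R) (fun x hx => by simpa using hR x hx) (d ())
  · convert hmem using 2 with x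
    exact (Finsupp.prod_fintype d (fun _ k => x ^ k) (by simp)).trans (by simp)
  · ext x
    simp [mul_comm]

theorem unifDense_network_euclidean {Ψ : ℝ → ℝ} (hΨ : MemM Ψ) (hb : LocBounded Ψ) {W I : Set ℝ}
    (hW : AccPt 0 (𝓟 W)) (hI : IsOpen I) (hIc : I.OrdConnected) (hP : ¬ AEPolynomialOn Ψ I)
    {r : ℕ} {A : Set (EuclideanSpace ℝ (Fin r))} (hA : NoHomogeneousVanishing A) :
    UnifDense (network Ψ ((W \ {0}) • A) I : Set (EuclideanSpace ℝ (Fin r) → ℝ)) := by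
  refine unifDense_of_monomials _ (fun (i : Fin r) x => x i) (fun i => by fun_prop)
    (fun x y h => by ext i; exact h i) fun K hK d => ?_
  refine monomial_mem_of_pow_mem hA _ (fun a ha k => ?_) d
  obtain ⟨R, hR⟩ := exists_abs_inner_le hK a
  have hS : ∀ w ∈ W, w ≠ 0 → ∀ θ ∈ I,
      (fun x => Ψ (w * inner ℝ a x + θ)) ∈ network Ψ ((W \ {0}) • A) I :=
    fun w hw hw0 θ hθ => Submodule.subset_span
      ⟨w • a, Set.smul_mem_smul ⟨hw, hw0⟩ ha, θ, hθ, by simp_rw [real_inner_smul_left]⟩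
  exact pow_mem_uniformClosureOn hΨ hb hI hIc hP hW _ (fun x => (inner ℝ a x : ℝ)) hS hR k

/-- Homogeneous polynomials of positive degree vanish at `0` anyway. For constants a single
remaining point suffices, and one exists since otherwise a coordinate would vanish on `A`; this is
where `1 ≤ r` enters. -/
theorem NoHomogeneousVanishing.diff_zero {r : ℕ} (hr : 1 ≤ r)
    {A : Set (EuclideanSpace ℝ (Fin r))} (hA : NoHomogeneousVanishing A) :
    NoHomogeneousVanishing (A \ {0}) := by
  intro k p hp h
  rcases Nat.eq_zero_or_pos k with rfl | hk
  · by_cases hne : (A \ {0}).Nonempty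
    · obtain ⟨a, ha⟩ := hne
      have hC := MvPolynomial.totalDegree_eq_zero_iff_eq_C.mp
        ((MvPolynomial.totalDegree_zero_iff_isHomogeneous _).mpr hp)
      have h0 := h a ha
      rw [hC, MvPolynomial.eval_C] at h0
      rw [hC, h0, map_zero]
    · exfalso
      have hX := hA 1 (MvPolynomial.X ⟨0, hr⟩) (MvPolynomial.isHomogeneous_X _ _) fun a ha => by
        have : a = 0 := by
          by_contra h0
          exact hne ⟨a, ha, h0⟩
        simp [this]
      exact MvPolynomial.X_ne_zero _ hX
  · refine hA k p hp fun a ha => ?_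
    by_cases h0 : a = 0
    · subst h0
      have : MvPolynomial.eval (fun i : Fin r => (0 : EuclideanSpace ℝ (Fin r)) i) p =
          MvPolynomial.coeff 0 p := by
        rw [← MvPolynomial.constantCoeff_eq, ← MvPolynomial.eval_zero']
        rfl
      rw [this]
      by_contra hc
      have := hp hc
      simp at this
      omega
    · exact h a ⟨ha, h0⟩

theorem noHomogeneousVanishing_univ (r : ℕ) :
    NoHomogeneousVanishing (Set.univ : Set (EuclideanSpace ℝ (Fin r))) := by
  intro k p _ h
  refine MvPolynomial.funext fun x => ?_
  rw [map_zero]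
  exact h (WithLp.toLp 2 x) trivial

theorem network_mono {E : Type*} [NormedAddCommGroup E] [InnerProductSpace ℝ E] (Ψ : ℝ → ℝ)
    {W W' : Set E} (h : W ⊆ W') (Θ : Set ℝ) : network Ψ W Θ ≤ network Ψ W' Θ :=
  Submodule.span_mono fun _ ⟨w, hw, θ, hθ, hf⟩ => ⟨w, h hw, θ, hθ, hf⟩

theorem UnifDense.mono {E : Type*} [TopologicalSpace E] {S T : Set (E → ℝ)} (hS : UnifDense S)
    (h : S ⊆ T) : UnifDense T := fun K hK hne g ε hε =>
  let ⟨f, hf, hfg⟩ := hS K hK hne g ε hε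
  ⟨f, h hf, hfg⟩

theorem UnifDense.essDense {E : Type*} [TopologicalSpace E] [MeasureSpace E] {S : Set (E → ℝ)}
    (hS : UnifDense S) : EssDense S := fun K hK hne g ε hε =>
  let ⟨f, hf, hfg⟩ := hS K hK hne g ε hε
  ⟨f, hf, Eventually.of_forall fun x hx => hfg ⟨x, hx⟩⟩

theorem EssDense.mono {E : Type*} [TopologicalSpace E] [MeasureSpace E] {S T : Set (E → ℝ)}
    (hS : EssDense S) (h : S ⊆ T) : EssDense T := fun K hK hne g ε hε =>
  let ⟨f, hf, hfg⟩ := hS K hK hne g ε hε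
  ⟨f, h hf, hfg⟩

/-! ### Changing the activation on a null set -/

section Euclidean

variable {E : Type*} [NormedAddCommGroup E] [InnerProductSpace ℝ E] [FiniteDimensional ℝ E]
  [MeasureSpace E] [BorelSpace E] [(volume : Measure E).IsAddHaarMeasure]

/-- Almost everywhere properties pull back along nonconstant affine functionals. -/
theorem ae_inner_add {p : ℝ → Prop} (hp : ∀ᵐ t, p t) {w : E} (hw : w ≠ 0) (θ : ℝ) :
    ∀ᵐ x : E, p (inner ℝ w x + θ) := by
  have hp' : ∀ᵐ t : ℝ, p (t + θ) :=
    (measurePreserving_add_right volume θ).quasiMeasurePreserving.ae hp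
  obtain ⟨s, hsub, hs, hs0⟩ := exists_measurable_superset_of_null hp'
  have hsurj : Function.Surjective (innerₛₗ ℝ w) := by
    intro t
    refine ⟨(t / inner ℝ w w) • w, ?_⟩
    have : (inner ℝ w w : ℝ) ≠ 0 := inner_self_ne_zero.mpr hw
    rw [innerₛₗ_apply_apply, real_inner_smul_right, div_mul_cancel₀ _ this]
  have hae := (ae_comp_linearMap_mem_iff (innerₛₗ ℝ w) (volume : Measure E) (volume : Measure ℝ)
    hsurj hs.compl).mpr (measure_eq_zero_iff_ae_notMem.mp hs0)
  filter_upwards [hae] with x hx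
  by_contra hcon
  exact hx (hsub hcon)

/-- Changing the activation function on a null set changes the networks without constant units on
null sets only. -/
theorem EssDense.network_congr_ae {Ψ Ψ' : ℝ → ℝ} (h : Ψ' =ᵐ[volume] Ψ) {W : Set E}
    (hW : (0 : E) ∉ W) {Θ : Set ℝ} (hd : EssDense (network Ψ' W Θ : Set (E → ℝ))) :
    EssDense (network Ψ W Θ : Set (E → ℝ)) := by
  have key : ∀ f ∈ network Ψ' W Θ, ∃ g ∈ network Ψ W Θ, f =ᵐ[volume] g := by
    intro f hf
    induction hf using Submodule.span_induction with
    | mem f hf =>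
      obtain ⟨w, hw, θ, hθ, rfl⟩ := hf
      exact ⟨_, Submodule.subset_span ⟨w, hw, θ, hθ, rfl⟩,
        ae_inner_add h (fun h0 => hW (h0 ▸ hw)) θ⟩
    | zero => exact ⟨0, Submodule.zero_mem _, .rfl⟩
    | add f₁ f₂ _ _ h₁ h₂ =>
      obtain ⟨g₁, hg₁, h₁⟩ := h₁
      obtain ⟨g₂, hg₂, h₂⟩ := h₂
      exact ⟨g₁ + g₂, Submodule.add_mem _ hg₁ hg₂, h₁.add h₂⟩
    | smul c f _ h =>
      obtain ⟨g, hg, h⟩ := h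
      exact ⟨c • g, Submodule.smul_mem _ c hg, h.const_smul c⟩
  intro K hK hne g ε hε
  obtain ⟨f, hf, hfg⟩ := hd K hK hne g ε hε
  obtain ⟨f', hf', hff'⟩ := key f hf
  refine ⟨f', hf', ?_⟩
  filter_upwards [hfg, hff'] with x hx hx' hxK
  rw [← hx']
  exact hx hxK

end Euclidean

/-- Every function of class `M` has a genuinely locally bounded representative of class `M`. -/
theorem MemM.exists_locBounded {Ψ : ℝ → ℝ} (hΨ : MemM Ψ) :
    ∃ Ψ' : ℝ → ℝ, Ψ' =ᵐ[volume] Ψ ∧ MemM Ψ' ∧ LocBounded Ψ' := by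
  -- `Ψ` is replaced by `0` on `D`. As `D` is closed, the new function agrees with `Ψ` near each
  -- point outside `D` and stays continuous there.
  set D := closure {x : ℝ | ¬ ContinuousAt Ψ x} with hD
  have hDc : IsClosed D := isClosed_closure
  have hae : Dᶜ.indicator Ψ =ᵐ[volume] Ψ := by
    have : ∀ᵐ x : ℝ, x ∉ D := measure_eq_zero_iff_ae_notMem.mp hΨ.2
    filter_upwards [this] with x hx
    exact Set.indicator_of_mem hx _
  have hcont : ∀ x ∉ D, ContinuousAt Ψ x := fun x hx => by
    by_contra h
    exact hx (subset_closure h)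
  refine ⟨Dᶜ.indicator Ψ, hae, ⟨fun K hK => ?_, ?_⟩, fun K hK => ?_⟩
  · exact (hΨ.1 K hK).ae_eq (ae_restrict_of_ae hae.symm)
  · refine measure_mono_null (closure_minimal (fun x hx => ?_) hDc) hΨ.2
    by_contra hxD
    refine hx ((hcont x hxD).congr ?_)
    filter_upwards [hDc.isOpen_compl.mem_nhds hxD] with y hy
    exact (Set.indicator_of_mem hy _).symm
  · obtain ⟨R, hR⟩ := hK.isBounded.subset_ball 0
    have hfin := (hΨ.1 _ (isCompact_closedBall (0 : ℝ) R)).2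
    rw [eLpNorm_exponent_top] at hfin
    have hle := ae_le_eLpNormEssSup (f := Ψ) (μ := volume.restrict (Metric.closedBall (0 : ℝ) R))
    set C := (eLpNormEssSup Ψ (volume.restrict (Metric.closedBall (0 : ℝ) R))).toReal
    have hle' : ∀ᵐ x : ℝ, x ∈ Metric.closedBall (0 : ℝ) R → |Ψ x| ≤ C := by
      rw [ae_restrict_iff' Metric.isClosed_closedBall.measurableSet] at hle
      filter_upwards [hle] with x hx hxR
      have := ENNReal.toReal_mono hfin.ne (hx hxR)
      simpa using this
    refine ⟨C, fun x hx => ?_⟩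
    by_cases hxD : x ∈ D
    · rw [Set.indicator_of_notMem (by simpa using hxD), abs_zero]
      exact ENNReal.toReal_nonneg
    · rw [Set.indicator_of_mem hxD]
      -- By continuity, a value above the essential bound would persist on a nonempty open set,
      -- which has positive measure.
      by_contra! hlt
      have hev : ∀ᶠ y in 𝓝 x, C < |Ψ y| ∧ y ∈ Metric.ball (0 : ℝ) R :=
        ((hcont x hxD).abs.eventually (lt_mem_nhds hlt)).and
          (Metric.isOpen_ball.mem_nhds (hR hx))
      obtain ⟨U, hU, hUo, hxU⟩ := eventually_nhds_iff.mp hev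
      refine (hUo.measure_pos volume ⟨x, hxU⟩).ne' (measure_mono_null (fun y hy => ?_) hle')
      intro hcon
      exact absurd (hcon (Metric.ball_subset_closedBall (hU y hy).2)) (not_le.mpr (hU y hy).1)

theorem AEPolynomialOn.congr_ae {f g : ℝ → ℝ} (h : f =ᵐ[volume] g) {I : Set ℝ}
    (hf : AEPolynomialOn f I) : AEPolynomialOn g I := by
  obtain ⟨P, hP⟩ := hf
  refine ⟨P, ?_⟩
  filter_upwards [hP, ae_restrict_of_ae h] with x hx hx'
  rw [← hx', hx]

/-! ### Necessity: finite differences -/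

/-- Networks with an almost everywhere polynomial activation function are not dense. -/
theorem not_essDense_of_aePolynomial {Ψ : ℝ → ℝ} {r : ℕ} (hr : 1 ≤ r)
    (hP : AEPolynomialOn Ψ Set.univ) :
    ¬ EssDense (sigmaNet r Ψ : Set (EuclideanSpace ℝ (Fin r) → ℝ)) := by
  obtain ⟨P, hP⟩ := hP
  rw [Measure.restrict_univ] at hP
  set n := P.natDegree + 1 with hn
  let e : EuclideanSpace ℝ (Fin r) := EuclideanSpace.single ⟨0, hr⟩ 1
  have he : ‖e‖ = 1 := by simp [e]
  let F : (EuclideanSpace ℝ (Fin r) → ℝ) → EuclideanSpace ℝ (Fin r) → ℝ := fun f x =>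
    ∑ j ∈ Finset.range (n + 1), ((-1 : ℝ) ^ (n - j) * n.choose j) * f (x + j • e)
  have hdiff : ∀ (Q : Polynomial ℝ) (y : ℝ), ∑ j ∈ Finset.range (n + 1),
      ((-1 : ℝ) ^ (n - j) * n.choose j) * Q.eval (y + j) = (fwdDiff 1)^[n] (fun t => Q.eval t) y := by
    intro Q y
    rw [fwdDiff_iter_eq_sum_shift]
    simp
  have hF : ∀ f ∈ sigmaNet r Ψ, ∀ᵐ x, F f x = 0 := by
    intro f hf
    induction hf using Submodule.span_induction with
    | mem f hf =>
      obtain ⟨w, _, θ, _, rfl⟩ := hf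
      have hQf : ∀ᵐ x : EuclideanSpace ℝ (Fin r), ∃ Q : Polynomial ℝ, Q.natDegree < n ∧
          ∀ j : ℕ, Ψ (inner ℝ w (x + j • e) + θ) = Q.eval (0 + j : ℝ) := by
        -- For `w = 0` the a.e. identity does not pull back, but the unit is constant and is killed
        -- all the same.
        by_cases hw : w = 0
        · exact Eventually.of_forall fun x => ⟨Polynomial.C (Ψ θ), by simp [hn], by simp [hw]⟩
        · have h1 := ae_all_iff.mpr fun j : ℕ =>
            ae_inner_add (E := EuclideanSpace ℝ (Fin r)) hP hw (inner ℝ w (j • e) + θ)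
          filter_upwards [h1] with x hx
          refine ⟨P.comp (Polynomial.C (inner ℝ w e) * Polynomial.X +
            Polynomial.C (inner ℝ w x + θ)), ?_, fun j => ?_⟩
          · have := Polynomial.natDegree_comp_le (p := P)
              (q := Polynomial.C (inner ℝ w e : ℝ) * Polynomial.X + Polynomial.C (inner ℝ w x + θ))
            have := Nat.mul_le_mul_left P.natDegree
              (Polynomial.natDegree_linear_le (a := (inner ℝ w e : ℝ)) (b := inner ℝ w x + θ))
            omega
          · rw [inner_add_right, add_assoc, hx j, ← Nat.cast_smul_eq_nsmul ℝ,
              real_inner_smul_right, Polynomial.eval_comp]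
            congr 1
            simp
            ring
      filter_upwards [hQf] with x ⟨Q, hQ, hx⟩
      simp only [F, hx, hdiff, Polynomial.fwdDiff_iter_eq_zero_of_degree_lt hQ, Pi.zero_apply]
    | zero => simp [F]
    | add f₁ f₂ _ _ h₁ h₂ =>
      filter_upwards [h₁, h₂] with x hx₁ hx₂
      simp only [F, Pi.add_apply, mul_add, Finset.sum_add_distrib] at *
      rw [hx₁, hx₂, add_zero]
    | smul c f _ h =>
      filter_upwards [h] with x hx
      simp only [F, Pi.smul_apply, smul_eq_mul, mul_left_comm _ c, ← Finset.mul_sum] at *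
      rw [hx, mul_zero]
  intro hd
  -- The radius accommodates `x + j • e` for `x` in the unit ball and `j ≤ n`.
  let K : Set (EuclideanSpace ℝ (Fin r)) := Metric.closedBall 0 (n + 1)
  let g : C(K, ℝ) := ⟨fun x => (inner ℝ e (x : EuclideanSpace ℝ (Fin r)) : ℝ) ^ n, by fun_prop⟩
  -- The binomial coefficients sum to `2 ^ n`, so the total error is at most `1 / 2`, less than
  -- `n!`.
  have hε : (0 : ℝ) < 1 / (2 * 2 ^ n) := by positivity
  obtain ⟨f, hf, hfg⟩ := hd K (isCompact_closedBall _ _) ⟨0, by simp [K]; positivity⟩ g _ hε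
  have hshift : ∀ᵐ x, ∀ j : ℕ, ∀ hx : x + j • e ∈ K, |f (x + j • e) - g ⟨x + j • e, hx⟩| <
      1 / (2 * 2 ^ n) := ae_all_iff.mpr fun j =>
    (measurePreserving_add_right volume (j • e)).quasiMeasurePreserving.ae hfg
  have hball : ∃ᵐ x : EuclideanSpace ℝ (Fin r), x ∈ Metric.ball 0 1 :=
    frequently_ae_mem_iff.mpr
      (Metric.isOpen_ball.measure_pos volume (Metric.nonempty_ball.mpr one_pos)).ne'
  obtain ⟨x, hx, hx0, hxs⟩ := (hball.and_eventually ((hF f hf).and hshift)).exists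
  rw [mem_ball_zero_iff] at hx
  have hclose : ∀ j ∈ Finset.range (n + 1),
      |f (x + j • e) - (inner ℝ e x + j : ℝ) ^ n| ≤ 1 / (2 * 2 ^ n) := by
    intro j hj
    have hjn : (j : ℝ) ≤ n := by exact_mod_cast Nat.lt_succ_iff.mp (Finset.mem_range.mp hj)
    have hmem : x + j • e ∈ K := by
      rw [mem_closedBall_zero_iff, ← Nat.cast_smul_eq_nsmul ℝ]
      refine (norm_add_le _ _).trans ?_
      rw [norm_smul, he, mul_one, Real.norm_natCast]
      linarith
    have hg : g ⟨x + j • e, hmem⟩ = (inner ℝ e x + j : ℝ) ^ n := by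
      change (inner ℝ e (x + j • e) : ℝ) ^ n = _
      rw [inner_add_right, ← Nat.cast_smul_eq_nsmul ℝ, real_inner_smul_right,
        real_inner_self_eq_norm_sq, he]
      simp
    rw [← hg]
    exact (hxs j hmem).le
  have hfac := hdiff (Polynomial.X ^ n) (inner ℝ e x)
  simp only [Polynomial.eval_pow, Polynomial.eval_X, fwdDiff_iter_eq_factorial] at hfac
  have hbound : (n.factorial : ℝ) ≤ 1 / 2 := by
    calc (n.factorial : ℝ) = |F f x - n.factorial| := by rw [hx0, zero_sub, abs_neg, Nat.abs_cast]
      _ = |∑ j ∈ Finset.range (n + 1), ((-1 : ℝ) ^ (n - j) * n.choose j) *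
            (f (x + j • e) - (inner ℝ e x + j : ℝ) ^ n)| := by
          simp only [mul_sub, Finset.sum_sub_distrib, hfac, F]
          simp
      _ ≤ ∑ j ∈ Finset.range (n + 1), (n.choose j : ℝ) * (1 / (2 * 2 ^ n)) := by
          refine (Finset.abs_sum_le_sum_abs _ _).trans (Finset.sum_le_sum fun j hj => ?_)
          rw [abs_mul, abs_mul, abs_pow, abs_neg, abs_one, one_pow, one_mul, Nat.abs_cast]
          exact mul_le_mul_of_nonneg_left (hclose j hj) (Nat.cast_nonneg _)
      _ = 1 / 2 := by
          rw [← Finset.sum_mul, ← Nat.cast_sum, Nat.sum_range_choose]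
          push_cast
          field_simp
  have : (1 : ℝ) ≤ n.factorial := by exact_mod_cast n.factorial_pos
  linarith

end ShallowNet

/-! ### Assembly -/

theorem mainTheorem1 (Ψ : ℝ → ℝ) (hΨ : ShallowNet.MemM Ψ) :
    ((∀ r : ℕ, 1 ≤ r →
        (ShallowNet.EssDense (ShallowNet.sigmaNet r Ψ : Set (EuclideanSpace ℝ (Fin r) → ℝ)) ↔
          ¬ ShallowNet.AEPolynomialOn Ψ Set.univ)) ∧
      (∀ W I : Set ℝ, Preperfect W → (0 : ℝ) ∈ W → IsOpen I → I.OrdConnected →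
        ¬ ShallowNet.AEPolynomialOn Ψ I →
        ShallowNet.EssDense (ShallowNet.network Ψ W I : Set (ℝ → ℝ)) ∧
        ∀ r : ℕ, 1 ≤ r → ∀ A : Set (EuclideanSpace ℝ (Fin r)),
          ShallowNet.NoHomogeneousVanishing A →
          ShallowNet.EssDense
            (ShallowNet.network Ψ (W • A) I : Set (EuclideanSpace ℝ (Fin r) → ℝ)))) ∧
    (ShallowNet.LocBounded Ψ →
      (∀ r : ℕ, 1 ≤ r →
        (ShallowNet.UnifDense (ShallowNet.sigmaNet r Ψ : Set (EuclideanSpace ℝ (Fin r) → ℝ)) ↔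
          ¬ ShallowNet.AEPolynomialOn Ψ Set.univ)) ∧
      (∀ W I : Set ℝ, Preperfect W → (0 : ℝ) ∈ W → IsOpen I → I.OrdConnected →
        ¬ ShallowNet.AEPolynomialOn Ψ I →
        ShallowNet.UnifDense (ShallowNet.network Ψ W I : Set (ℝ → ℝ)) ∧
        ∀ r : ℕ, 1 ≤ r → ∀ A : Set (EuclideanSpace ℝ (Fin r)),
          ShallowNet.NoHomogeneousVanishing A →
          ShallowNet.UnifDense
            (ShallowNet.network Ψ (W • A) I : Set (EuclideanSpace ℝ (Fin r) → ℝ)))) := by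
  have hunif : ShallowNet.LocBounded Ψ → ∀ W I : Set ℝ, Preperfect W → (0 : ℝ) ∈ W → IsOpen I →
      I.OrdConnected → ¬ ShallowNet.AEPolynomialOn Ψ I →
      ShallowNet.UnifDense (ShallowNet.network Ψ W I : Set (ℝ → ℝ)) ∧
      ∀ r : ℕ, 1 ≤ r → ∀ A : Set (EuclideanSpace ℝ (Fin r)),
        ShallowNet.NoHomogeneousVanishing A →
        ShallowNet.UnifDense
          (ShallowNet.network Ψ (W • A) I : Set (EuclideanSpace ℝ (Fin r) → ℝ)) := by
    intro hb W I hW h0 hI hIc hP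
    refine ⟨(ShallowNet.unifDense_network_real hΨ hb (hW 0 h0) hI hIc hP).mono
      (ShallowNet.network_mono Ψ Set.sdiff_subset I), fun r _ A hA => ?_⟩
    exact (ShallowNet.unifDense_network_euclidean hΨ hb (hW 0 h0) hI hIc hP hA).mono
      (ShallowNet.network_mono Ψ (Set.smul_subset_smul_right Set.sdiff_subset) I)
  have hess : ∀ W I : Set ℝ, Preperfect W → (0 : ℝ) ∈ W → IsOpen I →
      I.OrdConnected → ¬ ShallowNet.AEPolynomialOn Ψ I →
      ShallowNet.EssDense (ShallowNet.network Ψ W I : Set (ℝ → ℝ)) ∧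
      ∀ r : ℕ, 1 ≤ r → ∀ A : Set (EuclideanSpace ℝ (Fin r)),
        ShallowNet.NoHomogeneousVanishing A →
        ShallowNet.EssDense
          (ShallowNet.network Ψ (W • A) I : Set (EuclideanSpace ℝ (Fin r) → ℝ)) := by
    intro W I hW h0 hI hIc hP
    obtain ⟨Ψ', hae, hΨ', hb⟩ := hΨ.exists_locBounded
    have hP' : ¬ ShallowNet.AEPolynomialOn Ψ' I := fun h => hP (h.congr_ae hae)
    refine ⟨?_, fun r hr A hA => ?_⟩
    · exact ((ShallowNet.unifDense_network_real hΨ' hb (hW 0 h0) hI hIc hP').essDense.network_congr_ae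
        hae (by simp)).mono (ShallowNet.network_mono Ψ Set.sdiff_subset I)
    -- With `0` removed from both `W` and `A`, no product `w • a` vanishes, as the a.e. transfer
    -- requires.
    · refine ((ShallowNet.unifDense_network_euclidean hΨ' hb (hW 0 h0) hI hIc hP'
        (hA.diff_zero hr)).essDense.network_congr_ae hae ?_).mono
        (ShallowNet.network_mono Ψ (Set.smul_subset_smul Set.sdiff_subset Set.sdiff_subset) I)
      rintro ⟨w, hw, a, ha, h⟩
      rcases smul_eq_zero.mp h with h | h
      · exact hw.2 h
      · exact ha.2 h
  -- The sufficiency half of the first claim is the second claim with `W`, `A` and `I` all equal to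
  -- the whole space.
  have huniv : Preperfect (Set.univ : Set ℝ) := fun x _ => by
    rw [accPt_principal_iff_nhdsWithin, ← Set.compl_eq_univ_sdiff]
    infer_instance
  refine ⟨⟨fun r hr => ⟨fun h hP => ShallowNet.not_essDense_of_aePolynomial hr hP h, fun hP => ?_⟩,
    hess⟩, fun hb => ⟨fun r hr => ⟨fun h hP =>
      ShallowNet.not_essDense_of_aePolynomial hr hP h.essDense, fun hP => ?_⟩, hunif hb⟩⟩
  · exact ((hess _ _ huniv trivial isOpen_univ Set.ordConnected_univ hP).2 r hr _
      (ShallowNet.noHomogeneousVanishing_univ r)).mono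
      (ShallowNet.network_mono Ψ (Set.subset_univ _) _)
  · exact ((hunif hb _ _ huniv trivial isOpen_univ Set.ordConnected_univ hP).2 r hr _
      (ShallowNet.noHomogeneousVanishing_univ r)).mono
      (ShallowNet.network_mono Ψ (Set.subset_univ _) _)
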